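/- For a finite connected graph $G$ with vertex set $V$, let $e(v)=\max_{w\in V}d_G(v,w)$ be the eccentricity of $v\in V$ and let $\mathrm{avec}(G)=\frac1{|V|}\sum_{v\in V}e(v)$ be the average eccentricity of $G$. A graph is $C_4$-free if it contains no (not necessarily induced) subgraph isomorphic to the $4$-cycle. For integers $\delta,\Delta$ put $$\varepsilon_\Delta=\Delta\delta-2\left\lfloor\tfrac{\Delta}{2}\right\rfloor+1 .$$ Theorem. Let $\delta\ge 3$ be an integer such that $\delta+1$ is a prime power. There is a constant $C$, depending only on $\delta$, such that for all positive integers $n$ and $\Delta$ with $$n\equiv 0 \pmod{(\delta+1)(\delta+2)},\qquad \Delta\equiv\delta+1\pmod{\delta+2},\qquad \Delta\ge 2\delta-3,\qquad n>\delta(\Delta+1),$$ there exists a connected $C_4$-free graph $G$ of order $n$, minimum degree $\delta$ and maximum degree $\Delta$ with $$\mathrm{avec}(G)\ \ge\ \frac34\cdot\frac{n-\varepsilon_\Delta-\Delta}{(\delta+1)(\delta+2)}\left(1+\frac{\Delta(\delta+1)}{3n}\right)-C .$$ -/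

import Mathlib

/-- The average eccentricity `(1 / |V|) * ∑ v, e(v)` of a finite graph. The eccentricity is
Mathlib's `ℕ∞`-valued `SimpleGraph.eccent`, which is finite for connected finite graphs; the
average is only used for such graphs. -/
noncomputable def avec {V : Type*} [Fintype V] (G : SimpleGraph V) : ℝ :=
  (∑ v : V, ((G.eccent v).toNat : ℝ)) / (Fintype.card V : ℝ)

/-- A graph is `C₄`-free if it has no (not necessarily induced) subgraph isomorphic to the
cycle on four vertices. -/
def IsC4Free {V : Type*} (G : SimpleGraph V) : Prop :=
  (SimpleGraph.cycleGraph 4).Free G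

/-- The quantity `ε_Δ = Δ δ - 2 ⌊Δ / 2⌋ + 1`, as a real number
(the division `Δ / 2` is division of natural numbers, i.e. the floor). -/
def epsMax (δ Δ : ℕ) : ℝ :=
  (Δ : ℝ) * (δ : ℝ) - 2 * ((Δ / 2 : ℕ) : ℝ) + 1

/-! The graph is a hub of degree Δ followed by a long chain of blocks. With q = δ + 1, the polarity
graph of the plane over the field with q elements has q² + q + 1 vertices and no 4-cycle, since two
lines meet in one point; its degrees are q and q + 1.

Write Δ = δ + 1 + (δ + 2)j. The hub starts with degree δ + 1 in a slightly damaged polarity graph on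
(δ + 1)(δ + 2) vertices (`hasHub_base`). It then receives j petals: polarity graphs with a point z
deleted, whose δ + 2 former neighbours are joined to the hub instead. A petal has (δ + 1)(δ + 2)
vertices (`hasPetal_full`), or δ(δ + 2) if a conic is deleted too (`hasPetal_min`). Mixing the two
sizes hits the required order exactly (`exists_division`), and the remaining vertices form t blocks
of (δ + 1)(δ + 2) vertices joined by bridges, each adding 3 to a distance (`HasChain.add_block`).

Every eccentricity is at least half of any distance (`half_le_avec`), so avec ≥ 3t/2. This is
enough: the factor 1 + Δ(δ + 1)/(3n) is at most 2, and the rest is bounded by the constant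
(`bound_le`).

If j = 0, then δ is 3 or 4 and degree δ + 2 is not allowed; sum graphs of Sidon sets replace the
plane. -/

/-- The number of neighbours of a vertex. -/
noncomputable def nbrCount {V : Type*} (G : SimpleGraph V) (x : V) : ℕ :=
  (G.neighborSet x).ncard

/-- Two distinct vertices have at most one common neighbour. -/
def UniqueCommonNbr {V : Type*} (G : SimpleGraph V) : Prop :=
  ∀ ⦃u v w w' : V⦄, u ≠ v → G.Adj u w → G.Adj v w → G.Adj u w' → G.Adj v w' → w = w'

theorem UniqueCommonNbr.isC4Free {V : Type*} {G : SimpleGraph V} (h : UniqueCommonNbr G) :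
    IsC4Free G := by
  rintro ⟨f⟩
  have hadj : ∀ a b : Fin 4, (SimpleGraph.cycleGraph 4).Adj a b → G.Adj (f a) (f b) :=
    fun a b hab => f.toHom.map_adj hab
  have hinj := f.injective
  have h02 : f 0 ≠ f 2 := fun e => absurd (hinj e) (by decide)
  have h13 : f 1 ≠ f 3 := fun e => absurd (hinj e) (by decide)
  exact h13 (h h02 (hadj 0 1 (by decide)) (hadj 2 1 (by decide)) (hadj 0 3 (by decide))
    (hadj 2 3 (by decide)))

/-! ### Gluing two graphs through a vertex -/

/-- The graph obtained from disjoint copies of `G` and `K` by joining the vertex `v` of `G` to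
all vertices in the set `N` of vertices of `K`. -/
def attach {V W : Type*} (G : SimpleGraph V) (v : V) (K : SimpleGraph W) (N : Set W) :
    SimpleGraph (V ⊕ W) where
  Adj
    | .inl a, .inl b => G.Adj a b
    | .inr a, .inr b => K.Adj a b
    | .inl a, .inr b => a = v ∧ b ∈ N
    | .inr b, .inl a => a = v ∧ b ∈ N
  symm := ⟨by
    rintro (a | a) (b | b) h
    · exact G.adj_symm h
    · exact h
    · exact h
    · exact K.adj_symm h⟩
  loopless := ⟨by
    rintro (a | a) h
    · exact G.loopless.irrefl a h
    · exact K.loopless.irrefl a h⟩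

section attach

variable {V W : Type*} {G : SimpleGraph V} {v : V} {K : SimpleGraph W} {N : Set W}

@[simp] theorem attach_inl_inl {a b : V} :
    (attach G v K N).Adj (.inl a) (.inl b) ↔ G.Adj a b := Iff.rfl

@[simp] theorem attach_inr_inr {a b : W} :
    (attach G v K N).Adj (.inr a) (.inr b) ↔ K.Adj a b := Iff.rfl

@[simp] theorem attach_inl_inr {a : V} {b : W} :
    (attach G v K N).Adj (.inl a) (.inr b) ↔ a = v ∧ b ∈ N := Iff.rfl

@[simp] theorem attach_inr_inl {a : V} {b : W} :
    (attach G v K N).Adj (.inr b) (.inl a) ↔ a = v ∧ b ∈ N := Iff.rfl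

theorem attach_connected (hG : G.Connected) (hK : K.Connected) (hN : N.Nonempty) :
    (attach G v K N).Connected := by
  obtain ⟨p, hp⟩ := hN
  have hl : ∀ a, (attach G v K N).Reachable (.inl v) (.inl a) := fun a =>
    (hG.preconnected v a).map (⟨Sum.inl, fun h => h⟩ : G →g attach G v K N)
  have hr : ∀ a, (attach G v K N).Reachable (.inr p) (.inr a) := fun a =>
    (hK.preconnected p a).map (⟨Sum.inr, fun h => h⟩ : K →g attach G v K N)
  have hb : (attach G v K N).Adj (.inl v) (.inr p) := ⟨rfl, hp⟩
  rw [SimpleGraph.connected_iff_exists_forall_reachable]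
  refine ⟨.inl v, ?_⟩
  rintro (a | a)
  · exact hl a
  · exact hb.reachable.trans (hr a)

/-- The only new danger is a 4-cycle through `v` and two vertices of `N`; its fourth vertex would be
a common neighbour of these in `K`. -/
theorem attach_uniqueCommonNbr (hG : UniqueCommonNbr G) (hK : UniqueCommonNbr K)
    (hN : ∀ a ∈ N, ∀ b ∈ N, a ≠ b → ∀ x, K.Adj a x → ¬ K.Adj b x) :
    UniqueCommonNbr (attach G v K N) := by
  have key : ∀ {b c d}, K.Adj b c → K.Adj b d → c ∈ N → d ∈ N → c = d := by
    intro b c d h1 h2 h3 h4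
    by_contra hne
    exact hN c h3 d h4 hne b h1.symm h2.symm
  rintro (a | a) (b | b) (c | c) (d | d) hne h1 h2 h3 h4 <;>
    simp only [attach_inl_inl, attach_inr_inr, attach_inl_inr, attach_inr_inl, ne_eq,
      Sum.inl.injEq, Sum.inr.injEq, reduceCtorEq, not_false_eq_true] at *
  · exact hG hne h1 h2 h3 h4
  · exact hne (h3.1.trans h4.1.symm)
  · exact hne (h1.1.trans h2.1.symm)
  · exact absurd (h1.1.trans h2.1.symm) hne
  · exact h2.1.trans h4.1.symm
  · rw [h2.1, h3.1] at h1
    exact G.loopless.irrefl _ h1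
  · rw [h4.1, h1.1] at h3
    exact G.loopless.irrefl _ h3
  · exact key h2 h4 h1.2 h3.2
  · exact h1.1.trans h3.1.symm
  · rw [h1.1, h4.1] at h2
    exact G.loopless.irrefl _ h2
  · rw [h3.1, h2.1] at h4
    exact G.loopless.irrefl _ h4
  · exact key h1 h3 h2.2 h4.2
  · exact h1.1.trans h3.1.symm
  · exact hN a h1.2 b h2.2 hne d h3 h4
  · exact hN a h3.2 b h4.2 hne c h1 h2
  · exact hK hne h1 h2 h3 h4

theorem nbrCount_attach_inl_of_ne {x : V} (hx : x ≠ v) :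
    nbrCount (attach G v K N) (.inl x) = nbrCount G x := by
  have : (attach G v K N).neighborSet (.inl x) = Sum.inl '' G.neighborSet x := by
    ext (y | y) <;> simp [hx]
  rw [nbrCount, this, Set.ncard_image_of_injective _ Sum.inl_injective, nbrCount]

theorem nbrCount_attach_inl_self [Finite V] [Finite W] :
    nbrCount (attach G v K N) (.inl v) = nbrCount G v + N.ncard := by
  have : (attach G v K N).neighborSet (.inl v) = Sum.inl '' G.neighborSet v ∪ Sum.inr '' N := by
    ext (y | y) <;> simp
  rw [nbrCount, this, Set.ncard_union_eq, Set.ncard_image_of_injective _ Sum.inl_injective,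
    Set.ncard_image_of_injective _ Sum.inr_injective, nbrCount]
  rw [Set.disjoint_left]
  rintro _ ⟨a, -, rfl⟩ ⟨b, -, hb⟩
  cases hb

theorem nbrCount_attach_inr_of_notMem {x : W} (hx : x ∉ N) :
    nbrCount (attach G v K N) (.inr x) = nbrCount K x := by
  have : (attach G v K N).neighborSet (.inr x) = Sum.inr '' K.neighborSet x := by
    ext (y | y) <;> simp [hx]
  rw [nbrCount, this, Set.ncard_image_of_injective _ Sum.inr_injective, nbrCount]

theorem nbrCount_attach_inr_of_mem [Finite W] {x : W} (hx : x ∈ N) :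
    nbrCount (attach G v K N) (.inr x) = nbrCount K x + 1 := by
  have : (attach G v K N).neighborSet (.inr x) =
      insert (Sum.inl v) (Sum.inr '' K.neighborSet x) := by
    ext (y | y) <;> simp [hx]
  rw [nbrCount, this, Set.ncard_insert_of_notMem (by simp) (Set.toFinite _),
    Set.ncard_image_of_injective _ Sum.inr_injective, nbrCount]

end attach

/-! ### Petals, hubs, blocks and chains -/

/-- A graph `K` with a set `N` of vertices that can be joined to a common new vertex without
creating a 4-cycle, such that the resulting degrees in `K` lie between `δ` and `δ + 2`. -/
structure IsPetal {W : Type*} (δ : ℕ) (K : SimpleGraph W) (N : Set W) : Prop where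
  connected : K.Connected
  nonempty : N.Nonempty
  unique : UniqueCommonNbr K
  noCommonNbr : ∀ a ∈ N, ∀ b ∈ N, a ≠ b → ∀ x, K.Adj a x → ¬ K.Adj b x
  count_of_mem : ∀ w ∈ N, δ ≤ nbrCount K w + 1 ∧ nbrCount K w + 1 ≤ δ + 2
  count_of_notMem : ∀ w ∉ N, δ ≤ nbrCount K w ∧ nbrCount K w ≤ δ + 2

theorem IsPetal.nbrCount_attach {V W : Type*} [Finite W] {δ : ℕ} {K : SimpleGraph W} {N : Set W}
    (h : IsPetal δ K N) (G : SimpleGraph V) (v : V) (w : W) :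
    δ ≤ nbrCount (attach G v K N) (.inr w) ∧ nbrCount (attach G v K N) (.inr w) ≤ δ + 2 := by
  by_cases hw : w ∈ N
  · rw [nbrCount_attach_inr_of_mem hw]
    exact h.count_of_mem w hw
  · rw [nbrCount_attach_inr_of_notMem hw]
    exact h.count_of_notMem w hw

/-- There is a petal with `s` vertices, `c` of which are joined to the centre. -/
def HasPetal (δ s c : ℕ) : Prop :=
  ∃ (W : Type) (_ : Fintype W) (K : SimpleGraph W) (N : Set W),
    IsPetal δ K N ∧ Fintype.card W = s ∧ N.ncard = c

/-- There is a connected `UniqueCommonNbr` graph with `N` vertices, one of which has degree `d`, while the degrees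
of the others lie between `δ` and `δ + 2`. -/
def HasHub (δ N d : ℕ) : Prop :=
  ∃ (V : Type) (_ : Fintype V) (G : SimpleGraph V) (z m v : V),
    Fintype.card V = N ∧ G.Connected ∧ UniqueCommonNbr G ∧ nbrCount G z = d ∧
    nbrCount G m = δ ∧ m ≠ z ∧ v ≠ z ∧ v ≠ m ∧
    ∀ x, x ≠ z → δ ≤ nbrCount G x ∧ nbrCount G x ≤ δ + 2

/-- Only the hub `z` changes degree among old vertices. The vertex `m` keeps witnessing the minimum
degree, and `v` is reserved as the place where the chain will start. -/
theorem HasHub.add_petal {δ N d s c : ℕ} (h : HasHub δ N d) (hp : HasPetal δ s c) :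
    HasHub δ (N + s) (d + c) := by
  obtain ⟨V, _, G, z, m, v, hN, hG, hu, hz, hm, hmz, hvz, hvm, hd⟩ := h
  obtain ⟨W, _, K, A, hK, hs, hc⟩ := hp
  refine ⟨V ⊕ W, inferInstance, attach G z K A, .inl z, .inl m, .inl v, by simp [hN, hs],
    attach_connected hG hK.connected hK.nonempty,
    attach_uniqueCommonNbr hu hK.unique hK.noCommonNbr, ?_, ?_, by simpa, by simpa, by simpa, ?_⟩
  · rw [nbrCount_attach_inl_self, hz, hc]
  · rw [nbrCount_attach_inl_of_ne hmz, hm]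
  · rintro (x | x) hx
    · have hx' : x ≠ z := fun e => hx (by rw [e])
      rw [nbrCount_attach_inl_of_ne hx']
      exact hd x hx'
    · exact hK.nbrCount_attach G z x

theorem HasHub.add_petals {δ N d s c : ℕ} (h : HasHub δ N d) (hp : HasPetal δ s c) (i : ℕ) :
    HasHub δ (N + i * s) (d + i * c) := by
  induction i with
  | zero => simpa using h
  | succ i ih =>
    have := ih.add_petal hp
    rwa [add_assoc, ← Nat.succ_mul, add_assoc, ← Nat.succ_mul] at this

/-- There is a connected `UniqueCommonNbr` graph with `M` vertices and degrees between `δ` and `Δ`, with two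
non-adjacent vertices whose degrees can be increased. -/
def HasBlock (δ Δ M : ℕ) : Prop :=
  ∃ (W : Type) (_ : Fintype W) (K : SimpleGraph W) (p p' : W),
    Fintype.card W = M ∧ K.Connected ∧ UniqueCommonNbr K ∧
    (∀ x, δ ≤ nbrCount K x ∧ nbrCount K x ≤ Δ) ∧ nbrCount K p < Δ ∧ nbrCount K p' < Δ ∧
    p ≠ p' ∧ ¬ K.Adj p p'

/-- There is a connected `UniqueCommonNbr` graph with `N` vertices and extremal degrees `δ` and `Δ` which has two
vertices at distance at least `L`, as witnessed by a Lipschitz function `f`. -/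
def HasChain (δ Δ N L : ℕ) : Prop :=
  ∃ (V : Type) (_ : Fintype V) (G : SimpleGraph V) (z m v u : V) (f : V → ℕ),
    Fintype.card V = N ∧ G.Connected ∧ UniqueCommonNbr G ∧ nbrCount G z = Δ ∧
    nbrCount G m = δ ∧ v ≠ z ∧ v ≠ m ∧ nbrCount G v < Δ ∧
    (∀ x, δ ≤ nbrCount G x ∧ nbrCount G x ≤ Δ) ∧
    (∀ x y, G.Adj x y → f x ≤ f y + 1) ∧ f u = 0 ∧ f v = L

theorem HasHub.hasChain {δ N Δ : ℕ} (h : HasHub δ N Δ) (hΔ : δ + 2 < Δ) : HasChain δ Δ N 0 := by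
  obtain ⟨V, _, G, z, m, v, hN, hG, hu, hz, hm, hmz, hvz, hvm, hd⟩ := h
  refine ⟨V, inferInstance, G, z, m, v, v, fun _ => 0, hN, hG, hu, hz, hm, hvz, hvm,
    (hd v hvz).2.trans_lt hΔ, fun x => ?_, fun _ _ _ => by simp, rfl, rfl⟩
  by_cases hx : x = z
  · rw [hx, hz]
    omega
  · have := hd x hx
    omega

/-- A bridge from `v` to `p` costs 1 and the passage from `p` to its non-neighbour `p'` at least 2,
hence the 3. The function `f` is extended by the distance from `p`, truncated at 2. -/
theorem HasChain.add_block {δ Δ N L M : ℕ} (h : HasChain δ Δ N L) (hb : HasBlock δ Δ M) :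
    HasChain δ Δ (N + M) (L + 3) := by
  classical
  obtain ⟨V, _, G, z, m, v, u, f, hN, hG, hu, hz, hm, hvz, hvm, hv, hd, hf, hfu, hfv⟩ := h
  obtain ⟨W, _, K, p, p', hM, hK, hKu, hKd, hp, hp', hne, hadj⟩ := hb
  refine ⟨V ⊕ W, inferInstance, attach G v K {p}, .inl z, .inl m, .inr p', .inl u,
    Sum.elim f fun w => L + 1 + if w = p then 0 else if K.Adj p w then 1 else 2,
    by simp [hN, hM], attach_connected hG hK ⟨p, rfl⟩, attach_uniqueCommonNbr hu hKu ?_, ?_, ?_,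
    by simp, by simp, ?_, ?_, ?_, hfu, ?_⟩
  · rintro a rfl b rfl hab
    exact absurd rfl hab
  · rw [nbrCount_attach_inl_of_ne hvz.symm, hz]
  · rw [nbrCount_attach_inl_of_ne hvm.symm, hm]
  · rwa [nbrCount_attach_inr_of_notMem (fun e => hne e.symm)]
  · rintro (x | x)
    · by_cases hx : x = v
      · rw [hx, nbrCount_attach_inl_self, Set.ncard_singleton]
        have := hd v
        omega
      · rw [nbrCount_attach_inl_of_ne hx]
        exact hd x
    · by_cases hx : x = p
      · rw [hx, nbrCount_attach_inr_of_mem (Set.mem_singleton p)]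
        have := hKd p
        omega
      · rw [nbrCount_attach_inr_of_notMem (show x ∉ ({p} : Set W) from hx)]
        exact hKd x
  · rintro (x | x) (y | y) h
    · exact hf x y h
    · obtain ⟨rfl, rfl⟩ := h
      simp only [Sum.elim_inl, Sum.elim_inr]
      omega
    · obtain ⟨rfl, hx⟩ := h
      rw [Set.mem_singleton_iff] at hx
      simp [hx, hfv]
    · rw [attach_inr_inr] at h
      simp only [Sum.elim_inr]
      split_ifs <;> grind [SimpleGraph.adj_comm]
  · simp [hne.symm, hadj]

theorem HasChain.add_blocks {δ Δ N L M : ℕ} (h : HasChain δ Δ N L) (hb : HasBlock δ Δ M)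
    (t : ℕ) : HasChain δ Δ (N + t * M) (L + 3 * t) := by
  induction t with
  | zero => simpa using h
  | succ t ih =>
    have := ih.add_block hb
    rwa [add_assoc, ← Nat.succ_mul, add_assoc, ← Nat.mul_succ] at this

theorem HasHub.hasBlock {δ N d Δ : ℕ} (h : HasHub δ N d) (hd : δ ≤ d) (hd' : d ≤ δ + 2)
    (hN : δ + 4 ≤ N) (hΔ : δ + 2 < Δ) : HasBlock δ Δ N := by
  obtain ⟨V, _, G, z, m, v, hV, hG, hu, hz, hm, hmz, hvz, hvm, hb⟩ := h
  have hall : ∀ x, δ ≤ nbrCount G x ∧ nbrCount G x ≤ δ + 2 := fun x => by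
    by_cases hx : x = z
    · rw [hx, hz]
      exact ⟨hd, hd'⟩
    · exact hb x hx
  -- The closed neighbourhood of `z` has at most δ + 3 vertices, so it is not everything.
  obtain ⟨p', hp'⟩ : ∃ p', p' ∉ insert z (G.neighborSet z) := by
    by_contra! hcon
    have h1 : (insert z (G.neighborSet z)).ncard ≤ nbrCount G z + 1 := Set.ncard_insert_le _ _
    rw [Set.eq_univ_of_forall hcon, Set.ncard_univ, Nat.card_eq_fintype_card] at h1
    omega
  rw [Set.mem_insert_iff, not_or] at hp'
  exact ⟨V, inferInstance, G, z, p', hV, hG, hu, fun x => ⟨(hall x).1, by have := hall x; omega⟩,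
    (hall z).2.trans_lt hΔ, (hall p').2.trans_lt hΔ, Ne.symm hp'.1, hp'.2⟩

/-! ### From a long distance to the average eccentricity -/

theorem le_add_dist_of_lipschitz {V : Type*} {G : SimpleGraph V} (hG : G.Connected) {f : V → ℕ}
    (hf : ∀ x y, G.Adj x y → f x ≤ f y + 1) (x y : V) : f x ≤ f y + G.dist x y := by
  obtain ⟨w, hw⟩ := hG.exists_walk_length_eq_dist x y
  rw [← hw]
  clear hw
  induction w with
  | nil => simp
  | cons h p ih =>
    have := hf _ _ h
    rw [SimpleGraph.Walk.length_cons]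
    omega

/-- By the triangle inequality, each vertex is at distance at least `f v / 2` from `u` or from `v`.
-/
theorem half_le_avec {V : Type*} [Fintype V] {G : SimpleGraph V} (hG : G.Connected) {f : V → ℕ}
    (hf : ∀ x y, G.Adj x y → f x ≤ f y + 1) {u v : V} (hu : f u = 0) :
    (f v : ℝ) / 2 ≤ avec G := by
  have hV : Nonempty V := ⟨u⟩
  have hdist : ∀ x y : V, G.dist x y ≤ (G.eccent x).toNat := fun x y => by
    have h1 : G.edist x y ≤ G.eccent x := SimpleGraph.edist_le_eccent
    have h2 : G.eccent x ≠ ⊤ := by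
      obtain ⟨w, hw⟩ := G.exists_edist_eq_eccent_of_finite x
      rw [← hw]
      exact SimpleGraph.edist_ne_top_iff_reachable.2 (hG.preconnected x w)
    exact ENat.toNat_le_toNat h1 h2
  have hecc : ∀ x : V, (f v : ℝ) / 2 ≤ ((G.eccent x).toNat : ℝ) := fun x => by
    have h1 := hdist x u
    have h2 := hdist x v
    have h3 := le_add_dist_of_lipschitz hG hf v x
    have h4 := le_add_dist_of_lipschitz hG hf x u
    rw [SimpleGraph.dist_comm] at h3
    have : f v ≤ 2 * (G.eccent x).toNat := by omega
    have : (f v : ℝ) ≤ 2 * ((G.eccent x).toNat : ℝ) := by exact_mod_cast this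
    linarith
  rw [avec, le_div_iff₀ (by exact_mod_cast Fintype.card_pos)]
  calc (f v : ℝ) / 2 * (Fintype.card V : ℝ) = ∑ _x : V, (f v : ℝ) / 2 := by
        rw [Finset.sum_const, nsmul_eq_mul, Finset.card_univ, mul_comm]
    _ ≤ _ := Finset.sum_le_sum fun x _ => hecc x

theorem HasChain.exists_graph {δ Δ n L : ℕ} (h : HasChain δ Δ n L) :
    ∃ (G : SimpleGraph (Fin n)) (_ : DecidableRel G.Adj),
      G.Connected ∧ IsC4Free G ∧ G.minDegree = δ ∧ G.maxDegree = Δ ∧ (L : ℝ) / 2 ≤ avec G := by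
  classical
  obtain ⟨V, _, G₀, z, m, v, u, f, hn, hG, hu, hz, hm, -, -, -, hd, hf, hfu, hfv⟩ := h
  let e : Fin n ≃ V := (Fintype.equivFinOfCardEq hn).symm
  let G := G₀.comap e
  have hdeg : ∀ x, G.degree x = nbrCount G₀ (e x) := fun x => by
    have : G₀.neighborSet (e x) = e '' G.neighborSet x := by
      ext y
      obtain ⟨y, rfl⟩ := e.surjective y
      simp [G]
    rw [nbrCount, this, Set.ncard_image_of_injective _ e.injective,
      ← SimpleGraph.card_neighborSet_eq_degree, ← Nat.card_eq_fintype_card, Nat.card_coe_set_eq]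
  have hne : Nonempty (Fin n) := ⟨e.symm z⟩
  have hconn : G.Connected := (SimpleGraph.Iso.comap e G₀).connected_iff.2 hG
  refine ⟨G, inferInstance, hconn, UniqueCommonNbr.isC4Free ?_, ?_, ?_, ?_⟩
  · intro a b c d hab h1 h2 h3 h4
    exact e.injective (hu (e.injective.ne hab) h1 h2 h3 h4)
  · refine le_antisymm ?_ (G.le_minDegree_of_forall_le_degree _ fun x => ?_)
    · have := G.minDegree_le_degree (e.symm m)
      rwa [hdeg, e.apply_symm_apply, hm] at this
    · rw [hdeg]
      exact (hd _).1
  · refine le_antisymm (G.maxDegree_le_of_forall_degree_le _ fun x => ?_) ?_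
    · rw [hdeg]
      exact (hd _).2
    · have := G.degree_le_maxDegree (e.symm z)
      rwa [hdeg, e.apply_symm_apply, hz] at this
  · have := half_le_avec hconn (f := f ∘ e) (fun x y h => hf _ _ h) (u := e.symm u)
      (v := e.symm v) (by simpa using hfu)
    simpa [hfv] using this

/-! ### The polarity graph of a projective plane -/

/-- The points of the projective plane over `F`: `some (x, some y)` is the affine point `(x, y)`,
`some (m, none)` is the point at infinity of slope `m`, and `none` is the vertical point at
infinity. -/
abbrev PlanePt (F : Type*) := Option (F × Option F)

theorem ncard_pair_le {α : Type*} (a b : α) : ({a, b} : Set α).ncard ≤ 2 :=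
  (Set.ncard_insert_le _ _).trans (by rw [Set.ncard_singleton])

theorem card_planePt {F : Type*} [Fintype F] :
    Fintype.card (PlanePt F) = Fintype.card F * (Fintype.card F + 1) + 1 := by
  simp [PlanePt]

theorem card_compl_insert {F : Type*} [Fintype F] {z : PlanePt F} {T : Set (PlanePt F)} (hz : z ∉ T)
    [Fintype {x // x ∉ insert z T}] :
    Fintype.card {x // x ∉ insert z T} + T.ncard = Fintype.card F * (Fintype.card F + 1) := by
  have h1 := Set.ncard_add_ncard_compl (insert z T)
  rw [Set.ncard_insert_of_notMem hz (Set.toFinite _), Nat.card_eq_fintype_card, card_planePt] at h1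
  have h2 : (insert z T)ᶜ.ncard = Fintype.card {x // x ∉ insert z T} := by
    rw [← Nat.card_coe_set_eq, ← Nat.card_eq_fintype_card]
    rfl
  omega

section plane

variable {F : Type} [Field F]

/-- The relation between a point and the points of its polar line, with respect to a polarity of
the projective plane for which affine points `(a, b)`, `(c, d)` are related when `b + d = ac`. -/
def Polar : PlanePt F → PlanePt F → Prop
  | none, none => True
  | none, some (_, none) => True
  | some (_, none), none => True
  | none, some (_, some _) => False
  | some (_, some _), none => False
  | some (_, none), some (_, none) => False
  | some (m, none), some (a, some _) => m = a
  | some (a, some _), some (m, none) => m = a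
  | some (a, some b), some (c, some d) => b + d = a * c

/-- A parametrization of the polar line of a point. -/
def polarPt : PlanePt F → Option F → PlanePt F
  | none, none => none
  | none, some m => some (m, none)
  | some (_, none), none => none
  | some (m, none), some y => some (m, some y)
  | some (a, some _), none => some (a, none)
  | some (a, some b), some x => some (x, some (a * x - b))

theorem Polar.symm {u v : PlanePt F} (h : Polar u v) : Polar v u := by
  rcases u with _ | ⟨a, _ | b⟩ <;> rcases v with _ | ⟨c, _ | d⟩ <;> simp only [Polar] at h ⊢ <;>
    first | assumption | linear_combination h

theorem polar_iff_exists {u v : PlanePt F} : Polar u v ↔ ∃ t, polarPt u t = v := by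
  constructor
  · intro h
    rcases u with _ | ⟨a, _ | b⟩ <;> rcases v with _ | ⟨c, _ | d⟩ <;> simp only [Polar] at h
    · exact ⟨none, rfl⟩
    · exact ⟨some c, rfl⟩
    · exact ⟨none, rfl⟩
    · exact ⟨some d, by rw [h]; rfl⟩
    · exact ⟨none, by rw [h]; rfl⟩
    · exact ⟨some c, by simp only [polarPt]; rw [← h]; simp⟩
  · rintro ⟨t, rfl⟩
    rcases u with _ | ⟨a, _ | b⟩ <;> rcases t with _ | t <;> simp [Polar, polarPt]

theorem polarPt_injective (u : PlanePt F) : Function.Injective (polarPt u) := by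
  intro s t h
  rcases u with _ | ⟨a, _ | b⟩ <;> rcases s with _ | s <;> rcases t with _ | t <;>
    simp_all [polarPt]

/-- Two distinct polar lines share only one point; this is why polarity graphs have no 4-cycle. -/
theorem eq_of_polar {u v w w' : PlanePt F} (hne : u ≠ v) (h1 : Polar u w) (h2 : Polar v w)
    (h3 : Polar u w') (h4 : Polar v w') : w = w' := by
  rcases u with _ | ⟨a, _ | b⟩ <;> rcases v with _ | ⟨c, _ | d⟩ <;>
    rcases w with _ | ⟨x, _ | y⟩ <;> rcases w' with _ | ⟨x', _ | y'⟩ <;>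
    simp only [Polar] at h1 h2 h3 h4 <;> subst_vars <;> simp_all
  · grind
  · grind
  · grind
  · grind
  · have hac : a ≠ c := fun e => hne e (by subst e; linear_combination h1 - h2)
    have hx : x = x' := by
      apply mul_left_cancel₀ (sub_ne_zero.2 hac)
      linear_combination h2 - h1 + h3 - h4
    exact ⟨hx, by subst hx; linear_combination h1 - h3⟩

theorem ncard_polar [Fintype F] (u : PlanePt F) :
    {v | Polar u v}.ncard = Fintype.card F + 1 := by
  have : {v | Polar u v} = Set.range (polarPt u) := by
    ext v
    exact polar_iff_exists
  rw [this, ← Set.image_univ, Set.ncard_image_of_injective _ (polarPt_injective u),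
    Set.ncard_univ, Nat.card_eq_fintype_card, Fintype.card_option]

/-- The polarity graph of the projective plane, without the vertices in `D`. -/
def planeGraph (D : Set (PlanePt F)) : SimpleGraph {x // x ∉ D} where
  Adj u v := u ≠ v ∧ Polar u.1 v.1
  symm := ⟨fun _ _ h => ⟨h.1.symm, h.2.symm⟩⟩
  loopless := ⟨fun _ h => h.1 rfl⟩

theorem planeGraph_adj {D : Set (PlanePt F)} {u v : {x // x ∉ D}} :
    (planeGraph D).Adj u v ↔ u ≠ v ∧ Polar u.1 v.1 := Iff.rfl

theorem planeGraph_uniqueCommonNbr (D : Set (PlanePt F)) : UniqueCommonNbr (planeGraph D) :=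
  fun _ _ _ _ hne h1 h2 h3 h4 => Subtype.ext
    (eq_of_polar (fun e => hne (Subtype.ext e)) h1.2 h2.2 h3.2 h4.2)

/-- A vertex loses from its q + 1 polar points the deleted ones and, if it is self-polar, itself. -/
theorem nbrCount_planeGraph [Fintype F] (D : Set (PlanePt F)) (u : {x // x ∉ D}) :
    nbrCount (planeGraph D) u + {v | Polar u.1 v ∧ (v ∈ D ∨ v = u.1)}.ncard =
      Fintype.card F + 1 := by
  have h1 : nbrCount (planeGraph D) u = (Subtype.val '' (planeGraph D).neighborSet u).ncard :=
    (Set.ncard_image_of_injective _ Subtype.val_injective).symm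
  rw [h1, ← Set.ncard_union_eq _ (Set.toFinite _) (Set.toFinite _), ← ncard_polar u.1]
  · congr 1
    ext v
    simp only [Set.mem_union, Set.mem_image, SimpleGraph.mem_neighborSet, planeGraph_adj,
      Set.mem_ofPred_eq]
    constructor
    · rintro (⟨w, h, rfl⟩ | h)
      · exact h.2
      · exact h.1
    · intro h
      by_cases hv : v ∈ D ∨ v = u.1
      · exact Or.inr ⟨h, hv⟩
      · rw [not_or] at hv
        exact Or.inl ⟨⟨v, hv.1⟩, ⟨fun e => hv.2 (congrArg Subtype.val e).symm, h⟩, rfl⟩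
  · rw [Set.disjoint_left]
    rintro _ ⟨w, hw, rfl⟩ ⟨-, h | h⟩
    · exact w.2 h
    · exact hw.1 (Subtype.ext h.symm)

/-- A conic, one of whose points is at infinity. -/
def conic (l : F) : Set (PlanePt F) :=
  insert none (Set.range fun x => some (x, some (l * x ^ 2)))

theorem ncard_conic [Fintype F] (l : F) : (conic l).ncard = Fintype.card F + 1 := by
  rw [conic, Set.ncard_insert_of_notMem (by simp) (Set.toFinite _), ← Set.image_univ,
    Set.ncard_image_of_injective _ (fun x y h => by simpa using congrArg (Option.map Prod.fst) h),
    Set.ncard_univ, Nat.card_eq_fintype_card]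

/-- All points at infinity other than `none` survive, and each is adjacent to the surviving affine
points of its column. It remains to link the columns. -/
theorem planeGraph_connected [Fintype F] (hF : 4 ≤ Fintype.card F) {l a b : F}
    {D : Set (PlanePt F)} (hD : D ⊆ insert (some (a, some b)) (conic l)) :
    (planeGraph D).Connected := by
  classical
  have hinf : ∀ m : F, (some (m, none) : PlanePt F) ∉ D := fun m hm => by
    simpa [conic] using hD hm
  let p : F → {x // x ∉ D} := fun m => ⟨some (m, none), hinf m⟩
  have haff : ∀ (x y : F) (h : (some (x, some y) : PlanePt F) ∉ D),
      (planeGraph D).Adj (p x) ⟨some (x, some y), h⟩ := fun x y h =>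
    ⟨fun e => by simpa [p] using congrArg Subtype.val e, rfl⟩
  have hcol : ∀ m : F, (planeGraph D).Reachable (p a) (p m) := by
    intro m
    by_cases hm : m = a
    · rw [hm]
    -- The excluded values put (a, y) on the conic, (a, y) at (a, b), or (m, am - y) on the conic.
    obtain ⟨y, hy⟩ : ∃ y, y ∉ ({l * a ^ 2, b, a * m - l * m ^ 2} : Finset F) := by
      by_contra! hcon
      have h1 := Finset.card_le_three (a := l * a ^ 2) (b := b) (c := a * m - l * m ^ 2)
      rw [Finset.eq_univ_of_forall hcon, Finset.card_univ] at h1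
      omega
    simp only [Finset.mem_insert, Finset.mem_singleton, not_or] at hy
    have h1 : (some (a, some y) : PlanePt F) ∉ D := fun h => by
      have := hD h
      simp [conic, hy.2.1] at this
      exact hy.1 this.symm
    have h2 : (some (m, some (a * m - y)) : PlanePt F) ∉ D := fun h => by
      have := hD h
      simp [conic, hm] at this
      exact hy.2.2 (by rw [this]; ring)
    have h3 : (planeGraph D).Adj ⟨_, h1⟩ ⟨_, h2⟩ :=
      ⟨fun e => hm (by simpa using (congrArg (fun x => Option.map Prod.fst x.1) e).symm),
        by simp [Polar]⟩
    exact ((haff _ _ h1).reachable.trans h3.reachable).trans (haff _ _ h2).symm.reachable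
  rw [SimpleGraph.connected_iff_exists_forall_reachable]
  refine ⟨p a, ?_⟩
  rintro ⟨_ | ⟨x, _ | y⟩, h⟩
  · refine (hcol 0).trans (SimpleGraph.Adj.reachable ⟨fun e => ?_, trivial⟩)
    simpa [p] using congrArg Subtype.val e
  · exact hcol x
  · exact (hcol x).trans (haff x y h).reachable

/-- The polar line of a self-polar point is never a secant at two affine points of the conic. In odd
characteristic 2l = 1 makes the affine self-polar points exactly those of the conic, with their
tangents as polars; in characteristic 2 self-polarity forces c = 0, so the quadratic has a double
root. -/
theorem not_polar_self_of_two_roots {l c d x y : F} (hl : l ≠ 0) (h2 : (2 : F) = 0 ∨ 2 * l = 1)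
    (hx : l * x ^ 2 + d = c * x) (hy : l * y ^ 2 + d = c * y) (hne : x ≠ y) : d + d ≠ c * c := by
  intro h
  have hsub : x - y ≠ 0 := sub_ne_zero.2 hne
  have hc : l * (x + y) = c := by
    apply mul_right_cancel₀ hsub
    linear_combination hx - hy
  have hd : d = l * x * y := by
    subst hc
    linear_combination hx
  subst hc
  rw [hd] at h
  have h' : 2 * (x * y) = l * (x + y) ^ 2 := by
    apply mul_left_cancel₀ hl
    linear_combination h
  rcases h2 with h2 | h2
  · rw [h2, zero_mul] at h'
    have h3 : x + y = 0 := by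
      have := (mul_eq_zero.1 h'.symm).resolve_left hl
      exact pow_eq_zero_iff two_ne_zero |>.1 this
    apply hsub
    linear_combination h3 - y * h2
  · have h3 : (x - y) ^ 2 = 0 := by
      linear_combination (-2) * h' - (x + y) ^ 2 * h2
    exact hsub (pow_eq_zero_iff two_ne_zero |>.1 h3)

/-- A line meets the conic at most twice, and a self-polar point does not lose itself on top of two
conic points. So deleting the conic costs degree at most 2. -/
theorem ncard_polar_conic_le [Fintype F] {l : F} (hl : l ≠ 0) (h2 : (2 : F) = 0 ∨ 2 * l = 1)
    {u : PlanePt F} (hu : u ∉ conic l) :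
    {v | Polar u v ∧ (v ∈ conic l ∨ v = u)}.ncard ≤ 2 := by
  rcases u with _ | ⟨c, _ | d⟩
  · simp [conic] at hu
  · refine (Set.ncard_le_ncard (t := {none, some (c, some (l * c ^ 2))}) ?_
      (Set.toFinite _)).trans (ncard_pair_le _ _)
    rintro (_ | ⟨x, _ | y⟩) ⟨h1, h3⟩
    · simp
    · simp [Polar] at h1
    · simp only [Polar] at h1
      subst h1
      simpa [conic, eq_comm] using h3
  · by_contra hcon
    rw [not_le, Set.two_lt_ncard_iff] at hcon
    obtain ⟨v₁, v₂, v₃, hv₁, hv₂, hv₃, h12, h13, h23⟩ := hcon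
    have key : ∀ v ∈ {v | Polar (some (c, some d)) v ∧ (v ∈ conic l ∨ v = some (c, some d))},
        ∃ x, v = some (x, some (c * x - d)) ∧
          (l * x ^ 2 + d = c * x ∨ (x = c ∧ d + d = c * c)) := by
      rintro (_ | ⟨x, _ | y⟩) ⟨h1, h3⟩
      · simp [Polar] at h1
      · simp [conic] at h3
      · simp only [Polar] at h1
        have hy : y = c * x - d := by linear_combination h1
        refine ⟨x, by rw [hy], ?_⟩
        rcases h3 with h3 | h3
        · left
          simp [conic] at h3
          rw [h3, ← h1, add_comm]
        · right
          simp only [Option.some.injEq, Prod.mk.injEq] at h3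
          exact ⟨h3.1, by rw [h3.1, h3.2] at h1; exact h1⟩
    obtain ⟨x₁, rfl, e₁⟩ := key _ hv₁
    obtain ⟨x₂, rfl, e₂⟩ := key _ hv₂
    obtain ⟨x₃, rfl, e₃⟩ := key _ hv₃
    have n12 : x₁ ≠ x₂ := fun e => h12 (by rw [e])
    have n13 : x₁ ≠ x₃ := fun e => h13 (by rw [e])
    have n23 : x₂ ≠ x₃ := fun e => h23 (by rw [e])
    have hroots := fun x y => not_polar_self_of_two_roots (x := x) (y := y) (c := c) (d := d) hl h2
    -- Three roots contradict the degree of the quadratic, two roots and a self-polar point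
    -- contradict `hroots`, and the self-polar point cannot occur twice.
    rcases e₁ with e₁ | ⟨e₁, f₁⟩ <;> rcases e₂ with e₂ | ⟨e₂, f₂⟩ <;> rcases e₃ with e₃ | ⟨e₃, f₃⟩
    · apply n23
      have hc : l * (x₁ + x₂) = c := by
        apply mul_right_cancel₀ (sub_ne_zero.2 n12)
        linear_combination e₁ - e₂
      have hc' : l * (x₁ + x₃) = c := by
        apply mul_right_cancel₀ (sub_ne_zero.2 n13)
        linear_combination e₁ - e₃
      apply mul_left_cancel₀ hl
      linear_combination hc - hc'
    · exact hroots _ _ e₁ e₂ n12 f₃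
    · exact hroots _ _ e₁ e₃ n13 f₂
    · exact n23 (e₂.trans e₃.symm)
    · exact hroots _ _ e₂ e₃ n23 f₁
    · exact n13 (e₁.trans e₃.symm)
    · exact n12 (e₁.trans e₂.symm)
    · exact n12 (e₁.trans e₂.symm)

/-- Members of `N` already have the deleted point (a, b) as common neighbour, hence no other. The
new centre compensates them for its loss, so `h_mem` counts only `T`. -/
theorem isPetal_planeGraph [Fintype F] {δ : ℕ} (hF : Fintype.card F = δ + 1) (hδ : 3 ≤ δ)
    {l a b : F} {T N : Set (PlanePt F)} (hT : T ⊆ conic l) (hz : some (a, some b) ∉ T)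
    (hN : N.Nonempty) (hNz : N ⊆ {v | Polar (some (a, some b)) v})
    (hd : Disjoint N (insert (some (a, some b)) T))
    (h_mem : ∀ u ∈ N, {v | Polar u v ∧ (v ∈ T ∨ v = u)}.ncard ≤ 2)
    (h_notMem : ∀ u ∉ N, u ∉ insert (some (a, some b)) T →
      {v | Polar u v ∧ (v ∈ insert (some (a, some b)) T ∨ v = u)}.ncard ≤ 2) :
    IsPetal δ (planeGraph (insert (some (a, some b)) T)) {w | w.1 ∈ N} where
  connected := planeGraph_connected (by omega) (Set.insert_subset_insert hT)
  nonempty := by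
    obtain ⟨w, hw⟩ := hN
    exact ⟨⟨w, Set.disjoint_left.1 hd hw⟩, hw⟩
  unique := planeGraph_uniqueCommonNbr _
  noCommonNbr u hu v hv huv x hux hvx :=
    x.2 (Or.inl (eq_of_polar (fun e => huv (Subtype.ext e)) hux.2 hvx.2
      (hNz hu).symm (hNz hv).symm))
  count_of_mem u hu := by
    have h1 := nbrCount_planeGraph _ u
    have h2 := h_mem u.1 hu
    have h3 : {v | Polar u.1 v ∧ (v ∈ insert (some (a, some b)) T ∨ v = u.1)} =
        insert (some (a, some b)) {v | Polar u.1 v ∧ (v ∈ T ∨ v = u.1)} := by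
      ext v
      simp only [Set.mem_ofPred_eq, Set.mem_insert_iff]
      constructor
      · tauto
      · rintro (rfl | h)
        · exact ⟨(hNz hu).symm, Or.inl (Or.inl rfl)⟩
        · tauto
    rw [h3, Set.ncard_insert_of_notMem _ (Set.toFinite _)] at h1
    · omega
    · rintro ⟨-, h | h⟩
      · exact hz h
      · exact u.2 (Or.inl h.symm)
  count_of_notMem u hu := by
    have h1 := nbrCount_planeGraph _ u
    have h2 := h_notMem u.1 hu u.2
    omega

theorem ncard_subtype_mem {α : Type*} {D N : Set α} (h : Disjoint N D) :
    {w : {x // x ∉ D} | w.1 ∈ N}.ncard = N.ncard := by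
  rw [← Set.ncard_image_of_injective _ Subtype.val_injective]
  congr 1
  ext v
  simp only [Set.mem_image, Set.mem_ofPred_eq]
  exact ⟨by rintro ⟨w, h, rfl⟩; exact h, fun hv => ⟨⟨v, Set.disjoint_left.1 h hv⟩, hv, rfl⟩⟩

/-- This yields a point (a, b), neither self-polar nor on the conic, whose polar line misses the
conic. -/
theorem exists_coefficients [Fintype F] (hF : 4 ≤ Fintype.card F) :
    ∃ l a b : F, l ≠ 0 ∧ ((2 : F) = 0 ∨ 2 * l = 1) ∧
      (∀ x, l * x ^ 2 + b ≠ a * x) ∧ b + b ≠ a * a ∧ b ≠ l * a ^ 2 := by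
  classical
  have hns : ∀ l : F, l ≠ 0 → ∃ b, ∀ x, l * x ^ 2 + b ≠ x := fun l hl => by
    -- The map takes the value 0 at both 0 and l⁻¹, so on a finite field it omits some value.
    have : ¬ Function.Surjective fun x : F => x - l * x ^ 2 := fun hs => by
      have hinj := Finite.injective_iff_surjective.2 hs
      have : (0 : F) = l⁻¹ := hinj (by field_simp; simp)
      exact inv_ne_zero hl this.symm
    rw [Function.Surjective] at this
    push Not at this
    obtain ⟨b, hb⟩ := this
    exact ⟨b, fun x h => hb x (by linear_combination -h)⟩
  by_cases h2 : (2 : F) = 0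
  · have hself : ∀ b : F, b + b ≠ 1 * 1 := fun b h => by
      have : (1 : F) = 0 := by linear_combination b * h2 - h
      exact one_ne_zero this
    obtain ⟨b, hb⟩ := hns 1 one_ne_zero
    by_cases hb1 : b = 1
    · obtain ⟨y, hy⟩ : ∃ y, y ∉ ({0, 1} : Finset F) := by
        by_contra! hcon
        have h1 := Finset.card_le_two (a := (0 : F)) (b := 1)
        rw [Finset.eq_univ_of_forall hcon, Finset.card_univ] at h1
        omega
      simp only [Finset.mem_insert, Finset.mem_singleton, not_or] at hy
      -- Substituting x + y for x preserves the absence of roots in characteristic 2 and moves b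
      -- away from 1.
      refine ⟨1, 1, b + y - y ^ 2, one_ne_zero, Or.inl h2, fun x h => hb (x + y) ?_, hself _,
        fun h => ?_⟩
      · linear_combination h + (x * y + y ^ 2 - y) * h2
      · rw [hb1] at h
        have : y * (1 - y) = 0 := by linear_combination h
        rcases mul_eq_zero.1 this with h | h
        · exact hy.1 h
        · exact hy.2 (sub_eq_zero.1 h).symm
    · exact ⟨1, 1, b, one_ne_zero, Or.inl h2, by simpa using hb, hself b, by simpa using hb1⟩
  · obtain ⟨b, hb⟩ := hns 2⁻¹ (inv_ne_zero h2)
    have hl : (2 : F) * 2⁻¹ = 1 := mul_inv_cancel₀ h2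
    -- With a = 1 and l = 1/2, lying on the conic and being self-polar both mean b = 1/2, which
    -- would make x = 1 a root.
    have hself : b ≠ 2⁻¹ := fun h => hb 1 (by rw [h]; linear_combination hl)
    refine ⟨2⁻¹, 1, b, inv_ne_zero h2, Or.inr hl, by simpa using hb, fun h => hself ?_,
      by simpa using hself⟩
    apply mul_left_cancel₀ h2
    linear_combination h - hl

/-! ### Petals and the initial hub from the plane -/

theorem hasPetal_full [Fintype F] {δ : ℕ} (hF : Fintype.card F = δ + 1) (hδ : 3 ≤ δ) :
    HasPetal δ ((δ + 1) * (δ + 2)) (δ + 2) := by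
  classical
  obtain ⟨l, a, b, hl, h2, hroot, hself, -⟩ := exists_coefficients (F := F) (by omega)
  have hd : Disjoint {v | Polar (some (a, some b)) v}
      (insert (some (a, some b)) (∅ : Set (PlanePt F))) := by
    simpa [Polar] using hself
  refine ⟨_, inferInstance, _, _, isPetal_planeGraph hF hδ (l := l) (Set.empty_subset _) (by simp)
    ?_ subset_rfl hd (fun u _ => ?_) (fun u hu _ => ?_), ?_, ?_⟩
  · exact ⟨some (a, none), rfl⟩
  · refine (Set.ncard_le_ncard (t := {u}) ?_ (Set.toFinite _)).trans (by simp)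
    rintro v ⟨-, h | h⟩
    · exact h.elim
    · exact h
  · refine (Set.ncard_le_ncard (t := {u}) ?_ (Set.toFinite _)).trans (by simp)
    rintro v ⟨h1, (rfl | h) | h⟩
    · exact absurd h1.symm hu
    · exact h.elim
    · exact h
  · have := card_compl_insert (z := some (a, some b)) (T := (∅ : Set (PlanePt F))) (by simp)
    rwa [Set.ncard_empty, add_zero, hF] at this
  · rw [ncard_subtype_mem hd, ncard_polar, hF]

theorem hasPetal_min [Fintype F] {δ : ℕ} (hF : Fintype.card F = δ + 1) (hδ : 3 ≤ δ) :
    HasPetal δ (δ * (δ + 2)) (δ + 2) := by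
  classical
  obtain ⟨l, a, b, hl, h2, hroot, hself, hzc⟩ := exists_coefficients (F := F) (by omega)
  have hz : some (a, some b) ∉ conic l := by
    intro h
    simp [conic] at h
    exact hzc h.symm
  have hd : Disjoint {v | Polar (some (a, some b)) v} (insert (some (a, some b)) (conic l)) := by
    rw [Set.disjoint_left]
    rintro v hv (rfl | rfl | ⟨x, rfl⟩)
    · exact hself hv
    · exact hv
    · simp only [Set.mem_ofPred_eq, Polar] at hv
      exact hroot x (by rw [← hv, add_comm])
  refine ⟨_, inferInstance, _, _, isPetal_planeGraph hF hδ (l := l) subset_rfl hz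
    ?_ subset_rfl hd (fun u hu => ?_) (fun u hu hu' => ?_), ?_, ?_⟩
  · exact ⟨some (a, none), rfl⟩
  · exact ncard_polar_conic_le hl h2 (fun h => Set.disjoint_left.1 hd hu (Or.inr h))
  · refine (Set.ncard_le_ncard ?_ (Set.toFinite _)).trans
      (ncard_polar_conic_le hl h2 (u := u) (fun h => hu' (Or.inr h)))
    rintro v ⟨h1, (rfl | h) | h⟩
    · exact absurd h1.symm hu
    · exact ⟨h1, Or.inl h⟩
    · exact ⟨h1, Or.inr h⟩
  · have := card_compl_insert hz
    rw [ncard_conic, hF] at this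
    have e : (δ + 1) * (δ + 1 + 1) = δ * (δ + 2) + (δ + 1 + 1) := by ring
    omega
  · rw [ncard_subtype_mem hd, ncard_polar, hF]

/-- This is the polarity graph without `none` and without the edge from (a, b) to the infinite point
of slope a. The latter loses two neighbours and so has degree exactly δ; the new centre plays the
role of (a, b). -/
theorem hasHub_base [Fintype F] {δ : ℕ} (hF : Fintype.card F = δ + 1) (hδ : 3 ≤ δ) :
    HasHub δ ((δ + 1) * (δ + 2)) (δ + 1) := by
  classical
  obtain ⟨l, a, b, hl, h2, hroot, hself, -⟩ := exists_coefficients (F := F) (by omega)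
  have hz : (some (a, some b) : PlanePt F) ∉ ({none} : Set (PlanePt F)) := by simp
  have hd : Disjoint ({v | Polar (some (a, some b)) v} \ {some (a, none)})
      (insert (some (a, some b)) ({none} : Set (PlanePt F))) := by
    rw [Set.disjoint_left]
    rintro v ⟨hv, -⟩ (rfl | rfl)
    · exact hself hv
    · exact hv
  have hcount : ({v | Polar (some (a, some b)) v} \ {some (a, none)}).ncard = δ + 1 := by
    have h1 : (some (a, none) : PlanePt F) ∈ {v | Polar (some (a, some b)) v} := rfl
    rw [Set.ncard_sdiff_singleton_of_mem h1, ncard_polar, hF]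
    rfl
  have hinf : (some (a, none) : PlanePt F) ∉
      insert (some (a, some b)) ({none} : Set (PlanePt F)) := by simp
  have hzero : ∃ w : {x // x ∉ insert (some (a, some b)) ({none} : Set (PlanePt F))},
      w ≠ ⟨_, hinf⟩ := by
    refine ⟨⟨some (a + 1, none), by simp⟩, fun e => ?_⟩
    simpa using congrArg Subtype.val e
  obtain ⟨w, hw⟩ := hzero
  have hpetal := isPetal_planeGraph hF hδ (l := l) (T := {none})
    (N := {v | Polar (some (a, some b)) v} \ {some (a, none)}) (by simp [conic]) hz
    (Set.nonempty_of_ncard_ne_zero (by omega)) Set.sdiff_subset hd (fun u _ => by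
      refine (Set.ncard_le_ncard (t := {none, u}) ?_ (Set.toFinite _)).trans (ncard_pair_le _ _)
      rintro v ⟨-, h | h⟩
      · exact Or.inl h
      · exact Or.inr h) (fun u hu hu' => by
      by_cases hu'' : u = some (a, none)
      · refine (Set.ncard_le_ncard (t := {none, some (a, some b)}) ?_ (Set.toFinite _)).trans
          (ncard_pair_le _ _)
        subst hu''
        rintro v ⟨h1, (h | h) | h⟩
        · exact Or.inr h
        · exact Or.inl h
        · rw [h] at h1
          exact h1.elim
      · refine (Set.ncard_le_ncard (t := {none, u}) ?_ (Set.toFinite _)).trans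
          (ncard_pair_le _ _)
        rintro v ⟨h1, (rfl | h) | h⟩
        · exact absurd ⟨h1.symm, hu''⟩ hu
        · exact Or.inl h
        · exact Or.inr h)
  refine ⟨Unit ⊕ _, inferInstance, attach ⊥ () _ _, .inl (), .inr ⟨_, hinf⟩, .inr w, ?_,
    attach_connected ⟨fun _ _ => SimpleGraph.Reachable.refl _⟩ hpetal.connected hpetal.nonempty,
    attach_uniqueCommonNbr (fun _ _ _ _ _ h => h.elim) hpetal.unique hpetal.noCommonNbr,
    ?_, ?_, by simp, by simp, by simpa using hw, ?_⟩
  · have := card_compl_insert hz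
    rw [Set.ncard_singleton, hF] at this
    rw [Fintype.card_sum, Fintype.card_unit, add_comm]
    exact this
  · rw [nbrCount_attach_inl_self, ncard_subtype_mem hd, hcount]
    simp [nbrCount]
  · rw [nbrCount_attach_inr_of_notMem (by simp)]
    have h1 := nbrCount_planeGraph _ (⟨_, hinf⟩ :
      {x // x ∉ insert (some (a, some b)) ({none} : Set (PlanePt F))})
    have h3 : {v | Polar (some (a, none)) v ∧ (v ∈ insert (some (a, some b))
        ({none} : Set (PlanePt F)) ∨ v = some (a, none))} = {some (a, some b), none} := by
      ext v
      constructor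
      · rintro ⟨h1, h | h⟩
        · exact h
        · rw [h] at h1
          exact h1.elim
      · rintro (rfl | rfl)
        · exact ⟨rfl, Or.inl (Or.inl rfl)⟩
        · exact ⟨trivial, Or.inl (Or.inr rfl)⟩
    rw [h3, Set.ncard_pair (by simp), hF] at h1
    omega
  · rintro (x | x) hx
    · exact absurd rfl hx
    · exact hpetal.nbrCount_attach _ _ x

end plane

/-! ### Sum graphs of Sidon sets, for Δ = δ + 1 -/

/-- The graph on `ZMod N` in which two distinct vertices are adjacent when their sum lies
in `S`. -/
def sumGraph (N : ℕ) (S : Finset (ZMod N)) : SimpleGraph (ZMod N) where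
  Adj x y := x ≠ y ∧ x + y ∈ S
  symm := ⟨fun x y h => ⟨h.1.symm, add_comm x y ▸ h.2⟩⟩
  loopless := ⟨fun _ h => h.1 rfl⟩

theorem sumGraph_adj {N : ℕ} {S : Finset (ZMod N)} {x y : ZMod N} :
    (sumGraph N S).Adj x y ↔ x ≠ y ∧ x + y ∈ S := Iff.rfl

theorem sumGraph_connected {N : ℕ} {S : Finset (ZMod N)} (h0 : 0 ∈ S) (h1 : 1 ∈ S) :
    (sumGraph N S).Connected := by
  have hr : ∀ x y, x + y ∈ S → (sumGraph N S).Reachable x y := fun x y h => by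
    by_cases hxy : x = y
    · rw [hxy]
    · exact SimpleGraph.Adj.reachable ⟨hxy, h⟩
  -- Go from x to -x (sum 0) and on to x + 1 (sum 1).
  have hsucc : ∀ x, (sumGraph N S).Reachable x (x + 1) := fun x =>
    (hr x (-x) (by simpa)).trans (hr (-x) (x + 1) (by simpa))
  rw [SimpleGraph.connected_iff_exists_forall_reachable]
  refine ⟨0, fun x => ?_⟩
  obtain ⟨k, rfl⟩ := ZMod.intCast_surjective x
  induction k using Int.induction_on with
  | zero => simp
  | succ k ih =>
    have := ih.trans (hsucc _)
    exact_mod_cast this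
  | pred k ih =>
    have := hsucc ((-k - 1 : ℤ) : ZMod N)
    rw [show (((-k - 1 : ℤ) : ZMod N) + 1) = ((-k : ℤ) : ZMod N) by push_cast; ring] at this
    exact ih.trans this.symm

theorem sumGraph_uniqueCommonNbr {N : ℕ} {S : Finset (ZMod N)}
    (hS : ∀ a ∈ S, ∀ b ∈ S, ∀ c ∈ S, ∀ d ∈ S, a - b = c - d → a = b ∨ a = c) :
    UniqueCommonNbr (sumGraph N S) := by
  intro u v w w' hne h1 h2 h3 h4
  rcases hS _ h1.2 _ h2.2 _ h3.2 _ h4.2 (by ring) with h | h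
  · exact absurd (add_right_cancel h) hne
  · exact add_left_cancel h

theorem nbrCount_sumGraph {N : ℕ} [NeZero N] (S : Finset (ZMod N)) (x : ZMod N) :
    nbrCount (sumGraph N S) x + (if x + x ∈ S then 1 else 0) = S.card := by
  have h1 : ((fun s => s - x) '' (S : Set (ZMod N))).ncard = S.card := by
    rw [Set.ncard_image_of_injective _ (sub_left_injective), Set.ncard_coe_finset]
  have h2 : (sumGraph N S).neighborSet x = ((fun s => s - x) '' (S : Set (ZMod N))) \ {x} := by
    ext y
    simp only [SimpleGraph.mem_neighborSet, sumGraph_adj, Set.mem_sdiff, Set.mem_image,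
      Set.mem_singleton_iff, Finset.mem_coe]
    constructor
    · rintro ⟨h, h'⟩
      exact ⟨⟨_, h', by ring⟩, h.symm⟩
    · rintro ⟨⟨s, hs, rfl⟩, h⟩
      exact ⟨Ne.symm h, by simpa⟩
  rw [nbrCount, h2, ← h1]
  split_ifs with h
  · exact Set.ncard_sdiff_singleton_add_one ⟨x + x, h, by ring⟩ (Set.toFinite _)
  · rw [Set.sdiff_singleton_eq_self, add_zero]
    rintro ⟨s, hs, hsx⟩
    have : s = x + x := sub_eq_iff_eq_add.1 hsx
    exact h (this ▸ hs)

/-- A vertex x has degree δ exactly if 2x lies in `S`. Hence 0 and 2 have room for a bridge and are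
non-adjacent, 1 has degree δ + 1, and `m` has degree δ. -/
theorem hasBlock_and_hasChain_sumGraph {N δ : ℕ} [NeZero N] {S : Finset (ZMod N)}
    (hS : ∀ a ∈ S, ∀ b ∈ S, ∀ c ∈ S, ∀ d ∈ S, a - b = c - d → a = b ∨ a = c)
    (hc : S.card = δ + 1) (h0 : 0 ∈ S) (h1 : 1 ∈ S) (h4 : 4 ∈ S) (h2 : 2 ∉ S)
    {m : ZMod N} (hm : m + m = 0) (hm2 : m ≠ 2) (h02 : (0 : ZMod N) ≠ 2) (h12 : (1 : ZMod N) ≠ 2) :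
    HasBlock δ (δ + 1) N ∧ HasChain δ (δ + 1) N 0 := by
  have hcount := nbrCount_sumGraph S
  have hb : ∀ x, δ ≤ nbrCount (sumGraph N S) x ∧ nbrCount (sumGraph N S) x ≤ δ + 1 := fun x => by
    have := hcount x
    split_ifs at this <;> omega
  have hloop : ∀ x, x + x ∈ S → nbrCount (sumGraph N S) x = δ := fun x hx => by
    have := hcount x
    rw [if_pos hx] at this
    omega
  have c0 := hloop 0 (by simpa)
  have c2 := hloop 2 (by norm_num; exact h4)
  have cm := hloop m (by rwa [hm])
  have c1 := hcount 1
  rw [if_neg (by norm_num; exact h2)] at c1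
  have hconn := sumGraph_connected h0 h1
  have huniq := sumGraph_uniqueCommonNbr hS
  refine ⟨⟨ZMod N, ZMod.fintype N, sumGraph N S, 0, 2, ZMod.card N, hconn, huniq, hb, by omega,
    by omega, h02, fun h => h2 (by simpa using h.2)⟩, ⟨ZMod N, ZMod.fintype N, sumGraph N S, 1, m,
    2, 2, fun _ => 0, ZMod.card N, hconn, huniq, by omega, cm, h12.symm, hm2.symm, by omega, hb,
    fun _ _ _ => by simp, rfl, rfl⟩⟩

theorem hasBlock_and_hasChain_three : HasBlock 3 4 20 ∧ HasChain 3 4 20 0 :=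
  hasBlock_and_hasChain_sumGraph (S := {0, 1, 4, 6}) (m := 10) (by decide) (by decide) (by decide)
    (by decide) (by decide) (by decide) (by decide) (by decide) (by decide) (by decide)

theorem hasBlock_and_hasChain_four : HasBlock 4 5 30 ∧ HasChain 4 5 30 0 :=
  hasBlock_and_hasChain_sumGraph (S := {0, 1, 4, 9, 11}) (m := 15) (by decide) (by decide)
    (by decide) (by decide) (by decide) (by decide) (by decide) (by decide) (by decide) (by decide)

/-! ### Fitting the order, and the numerical bound -/

/-- Here `i` is the number of full petals, so it must not exceed `j`. Modulo q one has δ ≡ -1, so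
the remainder is congruent to `j`, and the least residue is at most `j`. -/
theorem exists_division {q δ k j : ℕ} (hq : q = δ + 1) (h : δ * (j + 1) < q * k) :
    ∃ t i, i ≤ j ∧ i < q ∧ q * k = δ * (j + 1) + 1 + (q * t + i) := by
  obtain ⟨r, hr⟩ := Nat.exists_eq_add_of_lt h
  have hdiv := Nat.div_add_mod r q
  have hlt : r % q < q := Nat.mod_lt _ (by omega)
  refine ⟨r / q, r % q, ?_, hlt, by omega⟩
  by_contra! hij
  have h1 : (q : ℤ) ∣ ((r % q : ℕ) : ℤ) - j := by
    refine ⟨k - (j + 1) - ((r / q : ℕ) : ℤ), ?_⟩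
    zify at hr hdiv hq ⊢
    rw [hq] at hr hdiv ⊢
    linear_combination hdiv - hr
  have h2 := Int.le_of_dvd (by omega) h1
  omega

theorem hasChain_of_division {F : Type} [Field F] [Fintype F] {δ j i t : ℕ}
    (hF : Fintype.card F = δ + 1) (hδ : 3 ≤ δ) (hj : 1 ≤ j) (hi : i ≤ j) :
    HasChain δ (δ + 1 + (δ + 2) * j)
      ((δ + 1) * (δ + 2) + i * ((δ + 1) * (δ + 2)) + (j - i) * (δ * (δ + 2))
        + t * ((δ + 1) * (δ + 2))) (3 * t) := by
  have hΔ : δ + 2 < δ + 1 + (δ + 2) * j := by nlinarith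
  have hbase := hasHub_base hF hδ
  have hblock : HasBlock δ (δ + 1 + (δ + 2) * j) ((δ + 1) * (δ + 2)) :=
    hbase.hasBlock (by omega) (by omega) (by nlinarith) hΔ
  have hhub := (hbase.add_petals (hasPetal_full hF hδ) i).add_petals (hasPetal_min hF hδ) (j - i)
  have e : δ + 1 + i * (δ + 2) + (j - i) * (δ + 2) = δ + 1 + (δ + 2) * j := by
    rw [add_assoc, ← add_mul, Nat.add_sub_cancel' hi, mul_comm]
  rw [e] at hhub
  simpa using (hhub.hasChain hΔ).add_blocks hblock t

theorem exists_field_card {q : ℕ} (hq : IsPrimePow q) :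
    ∃ (F : Type) (_ : Field F) (_ : Fintype F), Fintype.card F = q := by
  obtain ⟨p, k, hp, hk, rfl⟩ := hq
  have : Fact p.Prime := ⟨hp.nat_prime⟩
  let _ := Fintype.ofFinite (GaloisField p k)
  refine ⟨GaloisField p k, inferInstance, inferInstance, ?_⟩
  rw [← Nat.card_eq_fintype_card, GaloisField.card p k hk.ne']

theorem exists_hasChain {δ j k : ℕ} (hδ : 3 ≤ δ) (hq : IsPrimePow (δ + 1))
    (hΔ : 2 * δ - 3 ≤ δ + 1 + (δ + 2) * j) (h : δ * (j + 1) < (δ + 1) * k) :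
    ∃ t i, i < δ + 1 ∧ (δ + 1) * k = δ * (j + 1) + 1 + ((δ + 1) * t + i) ∧
      HasChain δ (δ + 1 + (δ + 2) * j) ((δ + 1) * (δ + 2) * k) (3 * t) := by
  obtain ⟨t, i, hij, hi, he⟩ := exists_division rfl h
  refine ⟨t, i, hi, he, ?_⟩
  rcases Nat.eq_zero_or_pos j with rfl | hj
  · obtain rfl : i = 0 := by omega
    have hk : k = 1 + t := by
      apply Nat.eq_of_mul_eq_mul_left (Nat.succ_pos δ)
      rw [Nat.succ_eq_add_one, he]
      ring
    -- For j = 0 the hypothesis reads 2δ - 3 ≤ δ + 1.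
    have hδ' : δ = 3 ∨ δ = 4 := by omega
    rw [hk]
    rcases hδ' with rfl | rfl
    · have := hasBlock_and_hasChain_three.2.add_blocks hasBlock_and_hasChain_three.1 t
      simpa [mul_add, mul_comm t] using this
    · have := hasBlock_and_hasChain_four.2.add_blocks hasBlock_and_hasChain_four.1 t
      simpa [mul_add, mul_comm t] using this
  · obtain ⟨F, _, _, hF⟩ := exists_field_card hq
    have := hasChain_of_division (t := t) hF hδ hj hij
    convert this using 1
    obtain ⟨s, rfl⟩ := Nat.exists_eq_add_of_le hij
    rw [Nat.add_sub_cancel_left]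
    linear_combination (δ + 2) * he

/-- The quotient is at most t + 2 and the bracket at most 2, so the product is at most (3/4) · 2(t +
2) = 3t/2 + 3; hence the constant 3. -/
theorem bound_le {δ j k t i n Δ : ℕ} (hδ : 3 ≤ δ) (hn : n = (δ + 1) * (δ + 2) * k)
    (hΔ : Δ = δ + 1 + (δ + 2) * j) (hlt : δ * (Δ + 1) < n) (hi : i < δ + 1)
    (he : (δ + 1) * k = δ * (j + 1) + 1 + ((δ + 1) * t + i)) :
    (3 / 4 : ℝ) * (((n : ℝ) - epsMax δ Δ - (Δ : ℝ)) / (((δ : ℝ) + 1) * ((δ : ℝ) + 2)))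
      * (1 + (Δ : ℝ) * ((δ : ℝ) + 1) / (3 * (n : ℝ))) - 3 ≤ ((3 * t : ℕ) : ℝ) / 2 := by
  have hn0 : (0 : ℝ) < n := by exact_mod_cast (Nat.zero_le _).trans_lt hlt
  have hlt' : (δ : ℝ) * (Δ + 1) < n := by exact_mod_cast hlt
  have hδ' : (3 : ℝ) ≤ δ := by exact_mod_cast hδ
  have hi' : (i : ℝ) ≤ δ := by exact_mod_cast Nat.lt_succ_iff.1 hi
  have hΔ0 : (0 : ℝ) ≤ Δ := Nat.cast_nonneg _
  have ht0 : (0 : ℝ) ≤ t := Nat.cast_nonneg _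
  have hfloor : (Δ : ℝ) ≤ 2 * ((Δ / 2 : ℕ) : ℝ) + 1 := by
    have : Δ ≤ 2 * (Δ / 2) + 1 := by omega
    exact_mod_cast this
  have hfloor' : 2 * ((Δ / 2 : ℕ) : ℝ) ≤ Δ := by
    have : 2 * (Δ / 2) ≤ Δ := by omega
    exact_mod_cast this
  have hx : ((n : ℝ) - epsMax δ Δ - (Δ : ℝ)) / (((δ : ℝ) + 1) * ((δ : ℝ) + 2)) ≤ t + 2 := by
    rw [div_le_iff₀ (by positivity), epsMax]
    have hn' : (n : ℝ) = (δ + 1) * (δ + 2) * k := by exact_mod_cast hn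
    have hΔ' : (Δ : ℝ) = δ + 1 + (δ + 2) * j := by exact_mod_cast hΔ
    have he' : ((δ : ℝ) + 1) * k = δ * (j + 1) + 1 + ((δ + 1) * t + i) := by exact_mod_cast he
    have h1 : (n : ℝ) - Δ * δ = (δ + 2) * (1 + ((δ + 1) * t + i)) + δ := by
      rw [hn', hΔ']
      linear_combination ((δ : ℝ) + 2) * he'
    have h2 : ((δ : ℝ) + 2) * i ≤ (δ + 2) * δ := by gcongr
    nlinarith
  have hy : (Δ : ℝ) * ((δ : ℝ) + 1) / (3 * (n : ℝ)) ≤ 1 := by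
    rw [div_le_one (by positivity)]
    nlinarith
  have hy0 : 0 ≤ (Δ : ℝ) * ((δ : ℝ) + 1) / (3 * (n : ℝ)) := by positivity
  set x := ((n : ℝ) - epsMax δ Δ - (Δ : ℝ)) / (((δ : ℝ) + 1) * ((δ : ℝ) + 2))
  set y := (Δ : ℝ) * ((δ : ℝ) + 1) / (3 * (n : ℝ))
  have h1 : x * (1 + y) ≤ (t + 2) * 2 := by
    calc x * (1 + y) ≤ (t + 2) * (1 + y) := by gcongr
      _ ≤ (t + 2) * 2 := by gcongr; linarith
  push_cast
  linarith

theorem theorem4 (δ : ℕ) (hδ : 3 ≤ δ) (hq : IsPrimePow (δ + 1)) :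
    ∃ C : ℝ, ∀ n Δ : ℕ,
      n ≡ 0 [MOD (δ + 1) * (δ + 2)] →
      Δ ≡ δ + 1 [MOD δ + 2] →
      2 * δ - 3 ≤ Δ →
      δ * (Δ + 1) < n →
      ∃ (G : SimpleGraph (Fin n)) (_ : DecidableRel G.Adj),
        G.Connected ∧ IsC4Free G ∧ G.minDegree = δ ∧ G.maxDegree = Δ ∧
        (3 / 4 : ℝ) * (((n : ℝ) - epsMax δ Δ - (Δ : ℝ)) / (((δ : ℝ) + 1) * ((δ : ℝ) + 2)))
            * (1 + (Δ : ℝ) * ((δ : ℝ) + 1) / (3 * (n : ℝ))) - C ≤ avec G := by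
  refine ⟨3, fun n Δ hn hmod hle hlt => ?_⟩
  obtain ⟨k, hk⟩ := (Nat.modEq_zero_iff_dvd).1 hn
  obtain ⟨j, hj⟩ : ∃ j, Δ = δ + 1 + (δ + 2) * j := by
    refine ⟨Δ / (δ + 2), ?_⟩
    have h1 : Δ % (δ + 2) = δ + 1 := by
      rw [hmod, Nat.mod_eq_of_lt (by omega)]
    have := Nat.div_add_mod Δ (δ + 2)
    omega
  have hlt' : δ * (j + 1) < (δ + 1) * k := by
    apply lt_of_mul_lt_mul_left (a := δ + 2) _ (Nat.zero_le _)
    calc (δ + 2) * (δ * (j + 1)) = δ * (Δ + 1) := by rw [hj]; ring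
      _ < n := hlt
      _ = (δ + 2) * ((δ + 1) * k) := by rw [hk]; ring
  obtain ⟨t, i, hi, he, hchain⟩ := exists_hasChain hδ hq (hj ▸ hle) hlt'
  rw [← hk, ← hj] at hchain
  obtain ⟨G, hdec, h1, h2, h3, h4, h5⟩ := hchain.exists_graph
  exact ⟨G, hdec, h1, h2, h3, h4, (bound_le hδ hk hj hlt hi he).trans h5⟩
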